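/- Let $\mathcal L$ be the propositional language with countably infinitely many atoms and the connectives $\neg$ and $\lor$. An argument $\Gamma\succ\Delta$ is a pair of finite sets of sentences of $\mathcal L$. A probabilistic model consists of a nonempty set $W$, an algebra $\mathcal A$ of subsets of $W$, a map $[\![\cdot]\!]:\mathcal L\to\mathcal A$ with $[\![\neg\varphi]\!]=W\setminus[\![\varphi]\!]$ and $[\![\varphi\lor\psi]\!]=[\![\varphi]\!]\cup[\![\psi]\!]$, and a finitely additive probability $P:\mathcal A\to[0,1]$; write $P(\varphi)=P([\![\varphi]\!])$. An upset is a set $\alpha\subseteq[0,1]$ with $1\in\alpha$, $0\notin\alpha$, such that $x\in\alpha$ and $x\le y\le 1$ imply $y\in\alpha$; its threshold is $\inf\alpha$. The $\alpha$-preservation consequence relation is the set of all arguments $\Gamma\succ\Delta$ for which there is no probabilistic model with $P(\gamma)\in\alpha$ for all $\gamma\in\Gamma$ and $P(\delta)\in[0,1]\setminus\alpha$ for all $\delta\in\Delta$. A preservation consequence relation is an $\alpha$-preservation consequence relation for some upset $\alpha$. Two consequence relations are incomparable if neither is a subset of the other. Theorem. Let $\alpha$ and $\beta$ be upsets whose thresholds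 are distinct elements of $(0,1]$. Then $\alpha$-preservation consequence and $\beta$-preservation consequence are incomparable. Corollary. There are uncountably many distinct preservation consequence relations, and any two distinct preservation consequence relations are incomparable. -/

import Mathlib

universe u

namespace ProbConsequence

/-- Sentences of the propositional language with countably infinitely many atoms, a unary
connective (negation) and a binary connective (disjunction). -/
inductive Sentence : Type
  | atom : ℕ → Sentence
  | neg : Sentence → Sentence
  | disj : Sentence → Sentence → Sentence

/-- An argument is a pair of finite sets of sentences. -/
structure Argument where
  premises : Finset Sentence
  conclusions : Finset Sentence

/-- A probabilistic model: a nonempty set `W` of worlds, an algebra `algebra` of subsets of `W`,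
a classical denotation function `den` with values in the algebra, and a finitely additive
probability function on the algebra. Only the values of `prob` on members of the algebra
are constrained, and only those are ever used. -/
structure ProbabilisticModel where
  W : Type u
  nonempty : Nonempty W
  algebra : Set (Set W)
  isSetAlgebra : MeasureTheory.IsSetAlgebra algebra
  den : Sentence → Set W
  den_mem : ∀ φ, den φ ∈ algebra
  den_neg : ∀ φ, den (Sentence.neg φ) = (den φ)ᶜ
  den_disj : ∀ φ ψ, den (Sentence.disj φ ψ) = den φ ∪ den ψ
  prob : Set W → ℝ
  prob_mem : ∀ A ∈ algebra, prob A ∈ Set.Icc (0 : ℝ) 1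
  prob_empty : prob ∅ = 0
  prob_compl : ∀ A ∈ algebra, prob Aᶜ = 1 - prob A
  prob_union : ∀ A ∈ algebra, ∀ B ∈ algebra, A ∩ B = ∅ → prob (A ∪ B) = prob A + prob B

/-- The probability of a sentence in a model. -/
def ProbabilisticModel.probSentence (M : ProbabilisticModel.{u}) (φ : Sentence) : ℝ :=
  M.prob (M.den φ)

/-- Upsets: upward closed subsets of `[0,1]` that contain `1` and do not contain `0`. -/
structure IsUpset (α : Set ℝ) : Prop where
  subset_Icc : α ⊆ Set.Icc (0 : ℝ) 1
  one_mem : (1 : ℝ) ∈ α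
  zero_notMem : (0 : ℝ) ∉ α
  mem_of_le : ∀ x ∈ Set.Icc (0 : ℝ) 1, ∀ y ∈ Set.Icc (0 : ℝ) 1, x ≤ y → x ∈ α → y ∈ α

/-- The threshold of an upset is its infimum (an upset is nonempty and bounded below). -/
noncomputable def threshold (α : Set ℝ) : ℝ := sInf α

/-- `M` is an `α`-preservation counterexample to the argument `A`: every premise has probability
in `α`, and every conclusion has probability in `[0,1] \ α`. -/
def IsPreservationCounterexample (α : Set ℝ) (M : ProbabilisticModel.{u}) (A : Argument) : Prop :=
  (∀ γ ∈ A.premises, M.probSentence γ ∈ α) ∧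
    ∀ δ ∈ A.conclusions, M.probSentence δ ∈ Set.Icc (0 : ℝ) 1 \ α

/-- The `α`-preservation consequence relation, as the set of all `α`-preservation valid
arguments: those that have no `α`-preservation counterexample. -/
def preservationConsequence (α : Set ℝ) : Set Argument :=
  {A | ¬ ∃ M : ProbabilisticModel.{u}, IsPreservationCounterexample α M A}

/-- Two consequence relations are incomparable when neither is a subset of the other. -/
def Incomparable (C D : Set Argument) : Prop := ¬ C ⊆ D ∧ ¬ D ⊆ C

/-- The collection of all preservation consequence relations. -/
def preservationConsequenceRelations : Set (Set Argument) :=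
  {C | ∃ α : Set ℝ, IsUpset α ∧ C = preservationConsequence.{u} α}

end ProbConsequence

/-! Let q = k/n be rational in [0,1]. Sentences can cut every model into n cells; take the n
sentences "the cell lies in I", for I a cyclic interval of length k. Each cell is counted k times,
so their probabilities average q: in every model one is at least q and one at most q, while n
equiprobable worlds make them all q. For q in α but not β, this set G makes `∅ ≻ G` valid for α only
and `G ≻ ∅` valid for β only. Distinct thresholds have such a q between them, and the upsets [a,1]
give uncountably many relations.

Distinct upsets with the same rational members differ only at one irrational a, and both agree with
(a,1] elsewhere. Their relations coincide: for a ℚ-linear L with L 1 = 0 and L a = ±1, replacing P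
by P + ε L(P) preserves additivity and total mass, and for small ε moves the value a to either side
without other values crossing a. Hence distinct relations are separated by a rational. -/

open Filter Topology

namespace ProbConsequence

/-! ### Partitions definable by sentences, and uniform models -/

namespace Sentence

/-- The classical denotation determined by a denotation of the atoms. -/
def eval {W : Type u} (v : ℕ → Set W) : Sentence → Set W
  | atom i => v i
  | neg φ => (eval v φ)ᶜ
  | disj φ ψ => eval v φ ∪ eval v ψ

/-- Conjunction, defined by De Morgan. -/
def conj (φ ψ : Sentence) : Sentence := neg (disj (neg φ) (neg ψ))

/-- A tautology. -/
def top : Sentence := disj (atom 0) (neg (atom 0))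

/-- A strict upper bound for the indices of the atoms of a sentence. -/
def atomBound : Sentence → ℕ
  | atom i => i + 1
  | neg φ => atomBound φ
  | disj φ ψ => max (atomBound φ) (atomBound ψ)

open Classical in
/-- The sentence saying that the first index in the list `l` whose atom is true (or `0`, if there
is none) belongs to `S`. -/
noncomputable def firstMem {n : ℕ} [NeZero n] (S : Finset (Fin n)) : List (Fin n) → Sentence
  | [] => if 0 ∈ S then top else neg top
  | i :: l => if i ∈ S then disj (atom i) (firstMem S l) else conj (neg (atom i)) (firstMem S l)

end Sentence

open Sentence

open Classical in
/-- The first index in the list `l` whose atomic proposition holds at `w`, or `0`. -/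
noncomputable def firstIndex {W : Type u} (v : ℕ → Set W) {n : ℕ} [NeZero n] (w : W) :
    List (Fin n) → Fin n
  | [] => 0
  | i :: l => if w ∈ v i then i else firstIndex v w l

namespace ProbabilisticModel

variable (M : ProbabilisticModel.{u})

lemma den_conj (φ ψ : Sentence) : M.den (conj φ ψ) = M.den φ ∩ M.den ψ := by
  simp [conj, M.den_neg, M.den_disj, Set.compl_union]

lemma den_top : M.den top = Set.univ := by
  simp [top, M.den_neg, M.den_disj]

/-- Each world has exactly one first index, so these sentences partition any model into n cells,
some possibly empty, with no assumption on the atoms. -/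
lemma den_firstMem {n : ℕ} [NeZero n] (S : Finset (Fin n)) (l : List (Fin n)) :
    M.den (firstMem S l) = {w | firstIndex (fun i => M.den (atom i)) w l ∈ S} := by
  induction l with
  | nil =>
    by_cases h : (0 : Fin n) ∈ S <;> simp [firstMem, firstIndex, h, M.den_neg, M.den_top]
  | cons i l ih =>
    ext w
    by_cases h : i ∈ S <;> by_cases hw : w ∈ M.den (atom i) <;>
      simp [firstMem, firstIndex, h, hw, M.den_neg, M.den_disj, M.den_conj, ih]

lemma probSentence_mem (φ : Sentence) : M.probSentence φ ∈ Set.Icc (0 : ℝ) 1 :=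
  M.prob_mem _ (M.den_mem φ)

lemma probSentence_firstMem_eq_sum {n : ℕ} [NeZero n] (S : Finset (Fin n)) (l : List (Fin n)) :
    M.probSentence (firstMem S l) = ∑ i ∈ S, M.probSentence (firstMem {i} l) := by
  classical
  induction S using Finset.induction_on with
  | empty => simp [probSentence, den_firstMem, M.prob_empty]
  | insert i S hi ih =>
    rw [Finset.sum_insert hi, ← ih]
    unfold probSentence
    rw [← M.prob_union _ (M.den_mem _) _ (M.den_mem _)]
    · congr 1
      ext w
      simp [den_firstMem]
    · ext w
      simp only [den_firstMem, Finset.mem_singleton, Set.mem_inter_iff, Set.mem_ofPred_eq,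
        Set.mem_empty_iff_false, iff_false, not_and]
      rintro rfl
      exact hi

lemma probSentence_firstMem_univ {n : ℕ} [NeZero n] (l : List (Fin n)) :
    M.probSentence (firstMem Finset.univ l) = 1 := by
  have h := M.prob_compl _ M.isSetAlgebra.empty_mem
  simpa [probSentence, den_firstMem, M.prob_empty] using h

/-- The model with `n` equiprobable worlds, in which the atom `i` is true exactly at world `i`. -/
noncomputable def uniform (n : ℕ) [NeZero n] : ProbabilisticModel.{u} where
  W := ULift.{u} (Fin n)
  nonempty := ⟨⟨0⟩⟩
  algebra := Set.univ
  isSetAlgebra := ⟨trivial, fun _ _ => trivial, fun _ _ _ _ => trivial⟩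
  den := Sentence.eval fun m => {w | (w.down : ℕ) = m}
  den_mem _ := trivial
  den_neg _ := rfl
  den_disj _ _ := rfl
  prob A := (A.ncard : ℝ) / n
  prob_mem A _ := by
    have hn : (0 : ℝ) < n := by exact_mod_cast Nat.pos_of_neZero n
    have h : A.ncard ≤ n := by
      simpa [Set.ncard_univ] using Set.ncard_le_ncard (Set.subset_univ A)
    refine ⟨by positivity, ?_⟩
    rw [div_le_one hn]
    exact_mod_cast h
  prob_empty := by simp
  prob_compl A _ := by
    have hn : (n : ℝ) ≠ 0 := by exact_mod_cast NeZero.ne n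
    have h : A.ncard + Aᶜ.ncard = n := by simpa using Set.ncard_add_ncard_compl A
    have h' : (A.ncard : ℝ) + Aᶜ.ncard = n := by exact_mod_cast h
    field_simp
    linarith
  prob_union A _ B _ h := by
    rw [Set.ncard_union_eq (Set.disjoint_iff_inter_eq_empty.mpr h)]
    push_cast
    ring

/-- Exactly one atom of the list holds at `w`, so the default 0 is never reached. -/
lemma firstIndex_uniform {n : ℕ} [NeZero n] (w : ULift.{u} (Fin n)) (l : List (Fin n))
    (h : w.down ∈ l) :
    firstIndex (fun i => (uniform.{u} n).den (atom i)) w l = w.down := by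
  induction l with
  | nil => simp at h
  | cons i l ih =>
    have hw : w ∈ (uniform.{u} n).den (atom i) ↔ w.down = i := by
      rw [Fin.ext_iff]; rfl
    by_cases hi : w.down = i
    · exact (if_pos (hw.2 hi)).trans hi.symm
    · exact (if_neg (mt hw.1 hi)).trans (ih (by simpa [hi] using h))

lemma probSentence_uniform_firstMem {n : ℕ} [NeZero n] (S : Finset (Fin n)) :
    (uniform.{u} n).probSentence (firstMem S (List.finRange n)) = (S.card : ℝ) / n := by
  have h : (uniform.{u} n).den (firstMem S (List.finRange n)) = ULift.down ⁻¹' (S : Set (Fin n)) := by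
    rw [den_firstMem]
    ext w
    rw [Set.mem_ofPred_eq, firstIndex_uniform w (List.finRange n) (List.mem_finRange _)]
    rfl
  have hc : (ULift.down ⁻¹' (S : Set (Fin n)) : Set (ULift.{u} (Fin n))).ncard = S.card := by
    rw [Set.ncard_preimage_of_injective_subset_range ULift.down_injective
      (by simp [ULift.down_surjective.range_eq]), Set.ncard_coe_finset]
  unfold probSentence
  rw [h, ← hc]
  rfl

end ProbabilisticModel

open ProbabilisticModel

/-! ### Cyclic intervals and balanced sets of sentences -/

/-- The cyclic interval of length `k` that starts at `j`. -/
def cyclicInterval {n : ℕ} [NeZero n] (k : ℕ) (j : Fin n) : Finset (Fin n) :=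
  Finset.univ.filter fun i => (i - j : Fin n).val < k

lemma card_filter_val_lt {n k : ℕ} (hk : k ≤ n) :
    (Finset.univ.filter fun i : Fin n => i.val < k).card = k := by
  rw [Fin.card_filter_val_lt, min_eq_right hk]

lemma card_cyclicInterval {n k : ℕ} [NeZero n] (hk : k ≤ n) (j : Fin n) :
    (cyclicInterval k j).card = k := by
  refine (Finset.card_equiv (Equiv.subRight j) ?_).trans (card_filter_val_lt hk)
  simp [cyclicInterval]

/-- For fixed `i`, the map `j ↦ i - j` is a bijection of `Fin n`. -/
lemma card_filter_mem_cyclicInterval {n k : ℕ} [NeZero n] (hk : k ≤ n) (i : Fin n) :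
    (Finset.univ.filter fun j => i ∈ cyclicInterval k j).card = k := by
  refine (Finset.card_equiv (Equiv.subLeft i) ?_).trans (card_filter_val_lt hk)
  simp [cyclicInterval]

lemma sum_sum_cyclicInterval {n k : ℕ} [NeZero n] (hk : k ≤ n) (x : Fin n → ℝ) :
    ∑ j, ∑ i ∈ cyclicInterval k j, x i = k * ∑ i, x i := by
  rw [Finset.sum_comm' (t' := Finset.univ)
    (s' := fun i => Finset.univ.filter fun j => i ∈ cyclicInterval k j) (by simp),
    Finset.mul_sum]
  refine Finset.sum_congr rfl fun i _ => ?_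
  rw [Finset.sum_const, card_filter_mem_cyclicInterval hk, nsmul_eq_mul]

/-- For each rational `q ∈ [0,1]` there is a finite set of sentences whose probabilities can all
equal `q`, but can neither all exceed `q` nor all be less than `q`. -/
lemma exists_balanced_sentences (q : ℚ) (hq : (q : ℝ) ∈ Set.Icc (0 : ℝ) 1) :
    ∃ G : Finset Sentence,
      (∀ M : ProbabilisticModel.{u}, ∃ φ ∈ G, (q : ℝ) ≤ M.probSentence φ) ∧
      (∀ M : ProbabilisticModel.{u}, ∃ φ ∈ G, M.probSentence φ ≤ q) ∧
      ∃ M : ProbabilisticModel.{u}, ∀ φ ∈ G, M.probSentence φ = q := by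
  classical
  obtain ⟨hq0, hq1⟩ := hq
  have hq0' : 0 ≤ q := by exact_mod_cast hq0
  have hq1' : q ≤ 1 := by exact_mod_cast hq1
  obtain ⟨n, k, hn, hk, hqk⟩ : ∃ n k : ℕ, n ≠ 0 ∧ k ≤ n ∧ (q : ℝ) = (k : ℝ) / n := by
    have hnum : ((q.num.toNat : ℤ)) = q.num := Int.toNat_of_nonneg (Rat.num_nonneg.2 hq0')
    refine ⟨q.den, q.num.toNat, q.den_nz, ?_, ?_⟩
    · have := Rat.num_le_denom_iff.2 hq1'
      omega
    · have h : ((q.num.toNat : ℕ) : ℝ) = (q.num : ℝ) := by exact_mod_cast hnum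
      rw [h, Rat.cast_def]
  have : NeZero n := ⟨hn⟩
  have hn0 : (n : ℝ) ≠ 0 := by exact_mod_cast hn
  -- By double counting the total is k times the mass 1 of all cells, and k = n q.
  have hsum : ∀ M : ProbabilisticModel.{u},
      ∑ j : Fin n, M.probSentence (firstMem (cyclicInterval k j) (List.finRange n))
        = ∑ _j : Fin n, (q : ℝ) := by
    intro M
    simp_rw [M.probSentence_firstMem_eq_sum (cyclicInterval k _)]
    rw [sum_sum_cyclicInterval hk, ← M.probSentence_firstMem_eq_sum Finset.univ,
      M.probSentence_firstMem_univ, hqk]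
    simp
    field_simp
  refine ⟨Finset.univ.image fun j => firstMem (cyclicInterval k j) (List.finRange n),
    fun M => ?_, fun M => ?_, uniform n, fun φ hφ => ?_⟩
  · obtain ⟨j, -, hj⟩ := Finset.exists_le_of_sum_le Finset.univ_nonempty (hsum M).ge
    exact ⟨_, Finset.mem_image_of_mem _ (Finset.mem_univ j), hj⟩
  · obtain ⟨j, -, hj⟩ := Finset.exists_le_of_sum_le Finset.univ_nonempty (hsum M).le
    exact ⟨_, Finset.mem_image_of_mem _ (Finset.mem_univ j), hj⟩
  · obtain ⟨j, -, rfl⟩ := Finset.mem_image.1 hφ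
    rw [probSentence_uniform_firstMem, card_cyclicInterval hk, hqk]

/-! ### Separation by a rational, and uncountability -/

lemma Incomparable.symm {C D : Set Argument} (h : Incomparable C D) : Incomparable D C :=
  And.symm h

lemma Incomparable.ne {C D : Set Argument} (h : Incomparable C D) : C ≠ D :=
  fun e => h.1 e.subset

/-- The balanced set for `q` serves once as conclusions and once as premises; the model giving all
its members probability `q` is the counterexample both times. -/
lemma incomparable_of_rat_mem_of_notMem {α β : Set ℝ} (hα : IsUpset α) (hβ : IsUpset β) {q : ℚ}
    (hqα : (q : ℝ) ∈ α) (hqβ : (q : ℝ) ∉ β) :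
    Incomparable (preservationConsequence.{u} α) (preservationConsequence.{u} β) := by
  have hq := hα.subset_Icc hqα
  obtain ⟨G, hle, hge, N, hN⟩ := exists_balanced_sentences.{u} q hq
  constructor
  · intro h
    refine h (a := ⟨∅, G⟩) ?_ ⟨N, by simp, fun φ hφ => ?_⟩
    · rintro ⟨M, -, hM⟩
      obtain ⟨φ, hφ, hqφ⟩ := hle M
      exact (hM φ hφ).2 (hα.mem_of_le _ hq _ (M.probSentence_mem φ) hqφ hqα)
    · rw [hN φ hφ]
      exact ⟨hq, hqβ⟩
  · intro h
    refine h (a := ⟨G, ∅⟩) ?_ ⟨N, fun φ hφ => ?_, by simp⟩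
    · rintro ⟨M, hM, -⟩
      obtain ⟨φ, hφ, hqφ⟩ := hge M
      exact hqβ (hβ.mem_of_le _ (M.probSentence_mem φ) _ hq hqφ (hM φ hφ))
    · rw [hN φ hφ]
      exact hqα

lemma IsUpset.mem_of_threshold_lt {α : Set ℝ} (hα : IsUpset α) {x : ℝ} (hx : x ∈ Set.Icc (0 : ℝ) 1)
    (h : threshold α < x) : x ∈ α := by
  obtain ⟨y, hy, hyx⟩ := exists_lt_of_csInf_lt ⟨1, hα.one_mem⟩ h
  exact hα.mem_of_le _ (hα.subset_Icc hy) _ hx hyx.le hy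

lemma IsUpset.notMem_of_lt_threshold {α : Set ℝ} (hα : IsUpset α) {x : ℝ}
    (h : x < threshold α) : x ∉ α :=
  fun hx => h.not_ge (csInf_le ⟨0, fun _ hy => (hα.subset_Icc hy).1⟩ hx)

lemma IsUpset.threshold_mem {α : Set ℝ} (hα : IsUpset α) : threshold α ∈ Set.Icc (0 : ℝ) 1 :=
  ⟨le_csInf ⟨1, hα.one_mem⟩ fun _ hy => (hα.subset_Icc hy).1,
    csInf_le ⟨0, fun _ hy => (hα.subset_Icc hy).1⟩ hα.one_mem⟩

lemma incomparable_of_threshold_lt {α β : Set ℝ} (hα : IsUpset α) (hβ : IsUpset β)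
    (h : threshold α < threshold β) :
    Incomparable (preservationConsequence.{u} α) (preservationConsequence.{u} β) := by
  obtain ⟨q, hαq, hqβ⟩ := exists_rat_btwn h
  exact incomparable_of_rat_mem_of_notMem hα hβ
    (hα.mem_of_threshold_lt ⟨hα.threshold_mem.1.trans hαq.le, hqβ.le.trans hβ.threshold_mem.2⟩ hαq)
    (hβ.notMem_of_lt_threshold hqβ)

lemma incomparable_of_threshold_ne {α β : Set ℝ} (hα : IsUpset α) (hβ : IsUpset β)
    (h : threshold α ≠ threshold β) :
    Incomparable (preservationConsequence.{u} α) (preservationConsequence.{u} β) := by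
  rcases h.lt_or_gt with h | h
  · exact incomparable_of_threshold_lt hα hβ h
  · exact (incomparable_of_threshold_lt hβ hα h).symm

lemma isUpset_Icc {a : ℝ} (ha : a ∈ Set.Ioc (0 : ℝ) 1) : IsUpset (Set.Icc a 1) where
  subset_Icc := Set.Icc_subset_Icc_left ha.1.le
  one_mem := ⟨ha.2, le_rfl⟩
  zero_notMem h := ha.1.not_ge h.1
  mem_of_le _ _ _ hy hxy hx := ⟨hx.1.trans hxy, hy.2⟩

lemma not_countable_preservationConsequenceRelations :
    ¬ (preservationConsequenceRelations.{u}).Countable := by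
  intro hc
  have hmaps : Set.MapsTo (fun a : ℝ => preservationConsequence.{u} (Set.Icc a 1)) (Set.Ioc 0 1)
      preservationConsequenceRelations.{u} := fun a ha => ⟨_, isUpset_Icc ha, rfl⟩
  have hinj : Set.InjOn (fun a : ℝ => preservationConsequence.{u} (Set.Icc a 1))
      (Set.Ioc 0 1) := by
    intro a ha b hb hab
    by_contra hne
    refine (incomparable_of_threshold_ne (isUpset_Icc ha) (isUpset_Icc hb) ?_).ne hab
    simpa [threshold, csInf_Icc ha.2, csInf_Icc hb.2] using hne
  have := Set.MapsTo.countable_of_injOn hmaps hinj hc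
  exact (Cardinal.Real.Ioc_countable_iff.not.2 (by norm_num)) this

/-! ### Perturbing a model along a rational-linear functional -/

lemma eventually_add_mul_pos {x : ℝ} (c : ℝ) (hx : 0 < x) :
    ∀ᶠ ε in 𝓝[>] (0 : ℝ), 0 < x + ε * c := by
  have h : Tendsto (fun ε : ℝ => x + ε * c) (𝓝[>] 0) (𝓝 (x + 0 * c)) :=
    (Continuous.tendsto (by fun_prop) 0).mono_left nhdsWithin_le_nhds
  exact h.eventually (lt_mem_nhds (by simpa using hx))

namespace ProbabilisticModel

variable (M : ProbabilisticModel.{u})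

/-- The truth pattern of the first `N` atoms at a world. -/
def pattern (N : ℕ) (w : M.W) : Fin N → Prop := fun i => w ∈ M.den (atom i)

/-- The members of the algebra that are determined by the first `N` atoms. -/
def restrictedAlgebra (N : ℕ) : Set (Set M.W) :=
  M.algebra ∩ Set.range (Set.preimage (M.pattern N))

/-- Finiteness lets a single ε keep all events nonnegative; `L` is not continuous, so no uniform
bound is available on an infinite algebra. -/
lemma finite_restrictedAlgebra (N : ℕ) : (M.restrictedAlgebra N).Finite :=
  (Set.finite_range _).inter_of_right _

lemma isSetAlgebra_restrictedAlgebra (N : ℕ) :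
    MeasureTheory.IsSetAlgebra (M.restrictedAlgebra N) where
  empty_mem := ⟨M.isSetAlgebra.empty_mem, ∅, rfl⟩
  compl_mem := by
    rintro _ ⟨h, S, rfl⟩
    exact ⟨M.isSetAlgebra.compl_mem h, Sᶜ, rfl⟩
  union_mem := by
    rintro _ _ ⟨h, S, rfl⟩ ⟨h', S', rfl⟩
    exact ⟨M.isSetAlgebra.union_mem h h', S ∪ S', rfl⟩

/-- The denotation that agrees with that of `M` on the first `N` atoms and makes the others
false. -/
def restrictedDen (N : ℕ) : Sentence → Set M.W :=
  Sentence.eval fun i => if i < N then M.den (atom i) else ∅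

lemma restrictedDen_mem (N : ℕ) (φ : Sentence) : M.restrictedDen N φ ∈ M.restrictedAlgebra N := by
  induction φ with
  | atom i =>
    by_cases h : i < N
    · rw [show M.restrictedDen N (atom i) = M.den (atom i) from if_pos h]
      exact ⟨M.den_mem _, {p | p ⟨i, h⟩}, rfl⟩
    · rw [show M.restrictedDen N (atom i) = ∅ from if_neg h]
      exact (M.isSetAlgebra_restrictedAlgebra N).empty_mem
  | neg φ ih => exact (M.isSetAlgebra_restrictedAlgebra N).compl_mem ih
  | disj φ ψ ih ih' => exact (M.isSetAlgebra_restrictedAlgebra N).union_mem ih ih'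

lemma restrictedDen_eq {N : ℕ} {φ : Sentence} (h : φ.atomBound ≤ N) :
    M.restrictedDen N φ = M.den φ := by
  induction φ with
  | atom i => exact if_pos h
  | neg φ ih =>
    rw [M.den_neg, ← ih h]
    rfl
  | disj φ ψ ih ih' =>
    rw [M.den_disj, ← ih ((le_max_left _ _).trans h), ← ih' ((le_max_right _ _).trans h)]
    rfl

/-- A model can be perturbed along any `ℚ`-linear functional that vanishes at `1`, as far as
finitely many sentences are concerned. -/
lemma eventually_exists_perturbation (F : Finset Sentence) (L : ℝ →ₗ[ℚ] ℚ) (hL : L 1 = 0) :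
    ∀ᶠ ε in 𝓝[>] (0 : ℝ), ∃ M' : ProbabilisticModel.{u}, ∀ φ ∈ F,
      M'.probSentence φ = M.probSentence φ + ε * L (M.probSentence φ) := by
  set N := F.sup atomBound
  have hnonneg : ∀ᶠ ε in 𝓝[>] (0 : ℝ), ∀ A ∈ M.restrictedAlgebra N,
      0 ≤ M.prob A + ε * L (M.prob A) := by
    refine (Filter.eventually_all_finite (M.finite_restrictedAlgebra N)).2 fun A hA => ?_
    -- Null events stay null because `L 0 = 0`; a positive probability survives a small change.
    rcases (M.prob_mem A hA.1).1.eq_or_lt with h | h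
    · simp [← h]
    · exact (eventually_add_mul_pos _ h).mono fun _ => le_of_lt
  filter_upwards [hnonneg] with ε hε
  have hcompl : ∀ A ∈ M.restrictedAlgebra N, M.prob Aᶜ + ε * L (M.prob Aᶜ) =
      1 - (M.prob A + ε * L (M.prob A)) := by
    intro A hA
    rw [M.prob_compl A hA.1, map_sub, hL]
    push_cast
    ring
  refine ⟨{ W := M.W
            nonempty := M.nonempty
            algebra := M.restrictedAlgebra N
            isSetAlgebra := M.isSetAlgebra_restrictedAlgebra N
            den := M.restrictedDen N
            den_mem := M.restrictedDen_mem N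
            den_neg := fun _ => rfl
            den_disj := fun _ _ => rfl
            prob := fun A => M.prob A + ε * L (M.prob A)
            prob_mem := fun A hA => ⟨hε A hA, ?_⟩
            prob_empty := by simp [M.prob_empty]
            prob_compl := hcompl
            prob_union := fun A hA B hB h => ?_ }, fun φ hφ => ?_⟩
  · have := hε _ ((M.isSetAlgebra_restrictedAlgebra N).compl_mem hA)
    rw [hcompl A hA] at this
    linarith
  · rw [M.prob_union A hA.1 B hB.1 h, map_add]
    push_cast
    ring
  · simp only [probSentence]
    rw [M.restrictedDen_eq (Finset.le_sup (f := atomBound) hφ)]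

end ProbabilisticModel

/-! ### Upsets with the same rational members -/

/-- Irrationality says that 1 and `a` are linearly independent over ℚ, so the two values can be
prescribed freely. -/
lemma exists_rat_linear_eq {a : ℝ} (ha : Irrational a) (c : ℚ) :
    ∃ L : ℝ →ₗ[ℚ] ℚ, L 1 = 0 ∧ L a = c := by
  have h : a ∉ Submodule.span ℚ {(1 : ℝ)} := by
    rw [Submodule.mem_span_singleton]
    rintro ⟨q, rfl⟩
    exact ha ⟨q, by simp [Rat.smul_def]⟩
  obtain ⟨f, hf, hker⟩ := Submodule.exists_le_ker_of_notMem h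
  refine ⟨(c / f a) • f, ?_, ?_⟩
  · have : f 1 = 0 := hker (Submodule.mem_span_singleton_self 1)
    simp [this]
  · simp [hf]

/-- Upsets that agree with `(a,1]` except possibly at an irrational number `a` have the same
counterexamples, up to a perturbation of the model. -/
lemma preservationConsequence_subset_of_irrational {α β : Set ℝ} {a : ℝ} (ha : Irrational a)
    (hα : ∀ x ∈ Set.Icc (0 : ℝ) 1, x ≠ a → (x ∈ α ↔ a < x))
    (hβ : ∀ x ∈ Set.Icc (0 : ℝ) 1, x ≠ a → (x ∈ β ↔ a < x)) :
    preservationConsequence.{u} α ⊆ preservationConsequence.{u} β := by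
  classical
  rintro A hA ⟨M, hΓ, hΔ⟩
  refine hA ?_
  -- The value `a` must move up if `β` contains it and down otherwise; it then no longer matters
  -- whether `α` contains `a`.
  obtain ⟨L, hL1, hLa⟩ := exists_rat_linear_eq ha (if a ∈ β then 1 else -1)
  have hsign : ∀ φ ∈ A.premises ∪ A.conclusions, ∀ᶠ ε in 𝓝[>] (0 : ℝ),
      M.probSentence φ + ε * L (M.probSentence φ) ≠ a ∧
      (a < M.probSentence φ + ε * L (M.probSentence φ) ↔ M.probSentence φ ∈ β) := by
    intro φ _
    rcases lt_trichotomy (M.probSentence φ) a with h | h | h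
    · filter_upwards [eventually_add_mul_pos (-(L (M.probSentence φ) : ℝ)) (sub_pos.2 h)] with ε hε
      rw [hβ _ (M.probSentence_mem φ) h.ne]
      exact ⟨by intro h'; linarith, by constructor <;> intro h' <;> linarith⟩
    · filter_upwards [self_mem_nhdsWithin] with ε (hε : 0 < ε)
      rw [h, hLa]
      split_ifs with hab
      · simp [hab, hε, hε.ne']
      · simp [hab, hε.le, hε.ne']
    · filter_upwards [eventually_add_mul_pos (L (M.probSentence φ) : ℝ) (sub_pos.2 h)] with ε hε
      rw [hβ _ (M.probSentence_mem φ) h.ne']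
      exact ⟨by intro h'; linarith, by constructor <;> intro h' <;> linarith⟩
  obtain ⟨ε, ⟨M', hM'⟩, hε⟩ :=
    ((M.eventually_exists_perturbation (A.premises ∪ A.conclusions) L hL1).and
      ((Filter.eventually_all_finset _).2 hsign)).exists
  have key : ∀ φ ∈ A.premises ∪ A.conclusions,
      (M'.probSentence φ ∈ α ↔ M.probSentence φ ∈ β) := by
    intro φ hφ
    have h := hε φ hφ
    rw [← hM' φ hφ] at h
    rw [hα _ (M'.probSentence_mem φ) h.1, h.2]
  exact ⟨M', fun γ hγ => (key γ (Finset.mem_union_left _ hγ)).2 (hΓ γ hγ),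
    fun δ hδ => ⟨M'.probSentence_mem δ,
      fun h => (hΔ δ hδ).2 ((key δ (Finset.mem_union_right _ hδ)).1 h)⟩⟩

/-- Two upsets with the same rational elements that differ at `a` agree with `(a,1]` elsewhere. -/
lemma IsUpset.mem_iff_lt_of_mem_of_notMem {α β : Set ℝ} (hα : IsUpset α) (hβ : IsUpset β)
    (h : ∀ q : ℚ, (q : ℝ) ∈ α ↔ (q : ℝ) ∈ β) {a : ℝ} (haα : a ∈ α) (haβ : a ∉ β) :
    Irrational a ∧ (∀ x ∈ Set.Icc (0 : ℝ) 1, x ≠ a → (x ∈ α ↔ a < x)) ∧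
      ∀ x ∈ Set.Icc (0 : ℝ) 1, x ≠ a → (x ∈ β ↔ a < x) := by
  have ha := hα.subset_Icc haα
  refine ⟨?_, fun x hx hxa => ⟨fun hxα => ?_, fun hax => hα.mem_of_le a ha x hx hax.le haα⟩,
    fun x hx hxa => ⟨fun hxβ => ?_, fun hax => ?_⟩⟩
  · rintro ⟨q, rfl⟩
    exact haβ ((h q).1 haα)
  · refine hxa.lt_or_gt.resolve_left fun hlt => ?_
    -- A rational between `x` and `a` would lie in `α`, hence in `β`, and would force `a` into `β`.
    obtain ⟨q, hxq, hqa⟩ := exists_rat_btwn hlt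
    have hq : (q : ℝ) ∈ Set.Icc (0 : ℝ) 1 := ⟨hx.1.trans hxq.le, hqa.le.trans ha.2⟩
    exact haβ (hβ.mem_of_le q hq a ha hqa.le ((h q).1 (hα.mem_of_le x hx q hq hxq.le hxα)))
  · exact hxa.lt_or_gt.resolve_left fun hlt => haβ (hβ.mem_of_le x hx a ha hlt.le hxβ)
  · obtain ⟨q, haq, hqx⟩ := exists_rat_btwn hax
    have hq : (q : ℝ) ∈ Set.Icc (0 : ℝ) 1 := ⟨ha.1.trans haq.le, hqx.le.trans hx.2⟩
    exact hβ.mem_of_le q hq x hx hqx.le ((h q).1 (hα.mem_of_le a ha q hq haq.le haα))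

lemma preservationConsequence_eq_of_rat {α β : Set ℝ} (hα : IsUpset α) (hβ : IsUpset β)
    (h : ∀ q : ℚ, (q : ℝ) ∈ α ↔ (q : ℝ) ∈ β) :
    preservationConsequence.{u} α = preservationConsequence.{u} β := by
  by_cases hαβ : ∀ a, a ∈ α ↔ a ∈ β
  · rw [Set.ext hαβ]
  obtain ⟨a, ha, hαa, hβa⟩ : ∃ a, Irrational a ∧
      (∀ x ∈ Set.Icc (0 : ℝ) 1, x ≠ a → (x ∈ α ↔ a < x)) ∧
      ∀ x ∈ Set.Icc (0 : ℝ) 1, x ≠ a → (x ∈ β ↔ a < x) := by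
    push Not at hαβ
    obtain ⟨a, ⟨h1, h2⟩ | ⟨h1, h2⟩⟩ := hαβ
    · exact ⟨a, hα.mem_iff_lt_of_mem_of_notMem hβ h h1 h2⟩
    · obtain ⟨h3, h4, h5⟩ := hβ.mem_iff_lt_of_mem_of_notMem hα (fun q => (h q).symm) h2 h1
      exact ⟨a, h3, h5, h4⟩
  exact (preservationConsequence_subset_of_irrational ha hαa hβa).antisymm
    (preservationConsequence_subset_of_irrational ha hβa hαa)

lemma incomparable_of_preservationConsequence_ne {α β : Set ℝ} (hα : IsUpset α) (hβ : IsUpset β)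
    (h : preservationConsequence.{u} α ≠ preservationConsequence.{u} β) :
    Incomparable (preservationConsequence.{u} α) (preservationConsequence.{u} β) := by
  have hq : ∃ q : ℚ, ¬ ((q : ℝ) ∈ α ↔ (q : ℝ) ∈ β) := by
    by_contra! hq
    exact h (preservationConsequence_eq_of_rat hα hβ hq)
  obtain ⟨q, hq⟩ := hq
  by_cases hqα : (q : ℝ) ∈ α
  · exact incomparable_of_rat_mem_of_notMem hα hβ hqα (by tauto)
  · exact (incomparable_of_rat_mem_of_notMem hβ hα (by tauto) hqα).symm

end ProbConsequence

theorem mainTheorem6 :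
    (∀ α β : Set ℝ, ProbConsequence.IsUpset α → ProbConsequence.IsUpset β →
      ProbConsequence.threshold α ∈ Set.Ioc (0 : ℝ) 1 →
      ProbConsequence.threshold β ∈ Set.Ioc (0 : ℝ) 1 →
      ProbConsequence.threshold α ≠ ProbConsequence.threshold β →
      ProbConsequence.Incomparable
        (ProbConsequence.preservationConsequence.{u} α)
        (ProbConsequence.preservationConsequence.{u} β)) ∧
    ¬ (ProbConsequence.preservationConsequenceRelations.{u}).Countable ∧
    (∀ C ∈ ProbConsequence.preservationConsequenceRelations.{u},
      ∀ D ∈ ProbConsequence.preservationConsequenceRelations.{u},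
        C ≠ D → ProbConsequence.Incomparable C D) := by
  refine ⟨fun α β hα hβ _ _ h => ProbConsequence.incomparable_of_threshold_ne hα hβ h,
    ProbConsequence.not_countable_preservationConsequenceRelations, ?_⟩
  rintro _ ⟨α, hα, rfl⟩ _ ⟨β, hβ, rfl⟩ h
  exact ProbConsequence.incomparable_of_preservationConsequence_ne hα hβ h
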